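/- A cone is a commutative monoid $(C,+,0)$ with an action of the semiring $\mathbb R_+$ satisfying the module axioms; it is semitopological if it has a topology for which $+$ and $\cdot$ are separately continuous, $\mathbb R_+$ carrying its Scott topology (open sets $\emptyset$, $\mathbb R_+$ and $]a,\infty[$). A barycentric algebra is a set $B$ with operations $+_a$ ($a\in[0,1]$) such that $x+_1y=x$, $x+_ax=x$, $x+_ay=y+_{1-a}x$, and $(x+_ay)+_bz=x+_{ab}(y+_{(1-a)b/(1-ab)}z)$ if $a,b<1$; it is semitopological if it has a topology for which $(x,a,y)\mapsto x+_ay$ is separately continuous, $[0,1]$ carrying its usual topology. Cones are barycentric algebras with $x+_ay=a\cdot x+(1-a)\cdot y$, and affine maps are those that preserve all operations $+_a$. For a topological space $X$, a continuous valuation is a strict, modular, Scott-continuous map $\nu$ from the open subsets of $X$ to $[0,\infty]$; it is point-continuous if it is continuous from the set of open subsets of $X$, with the topology generated by the sets $\{U\mid x\in U\}$ ($x\in X$), to $[0,\infty]$ with its Scott topology. All sets of continuous valuations carry the pointwise operations and the weak topology, generated by the sets $\{\nu\mid \nu(U)>r\}$ ($U$ open, $r>0$). Let $V_bX$ (resp.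 $V_1X$) be the space of continuous valuations with $\nu(X)<\infty$ (resp. $\nu(X)=1$), and $V_{b,p}X$, $V_{1,p}X$ their subspaces of point-continuous valuations. For a semitopological barycentric algebra $B$, let $\mathcal C(B)$ be the cone consisting of $0$ and of the pairs $(r,x)$ with $r>0$ and $x\in B$, with $a\cdot(r,x)=(ar,x)$ for $a>0$, $0\cdot(r,x)=0$, $(r,x)+(s,y)=(r+s,x+_{r/(r+s)}y)$ and $0$ neutral. Preorder it by: $0\le 0$, and $u\le(s,y)$ if and only if $u+u'=(s,y_1)$ for some $u'\in\mathcal C(B)$ and some $y_1\in B$ such that every open neighborhood of $y_1$ contains $y$. Give $\mathcal C(B)$ the cone topology, which has as subbase the open subsets of $(\mathbb R_+\setminus\{0\})\times B$ that are upwards-closed in $\mathcal C(B)$, where $\mathbb R_+\setminus\{0\}$ has its Scott topology. **Theorem.** 1. For every topological space $X$, $V_bX$, with the inclusion of $V_1X$, is the free cone over the barycentric algebra $V_1X$: for every cone $C$, every affine map $f:V_1X\to C$ extends to a unique linear map $\hat f:V_bX\to C$. Moreover $V_bX$ is the free semitopological cone over $V_1X$: $V_1X$ is a semitopological barycentric algebra,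 $V_bX$ is a semitopological cone, the inclusion is affine and continuous, and every affine continuous map $f$ from $V_1X$ to a semitopological cone $C$ extends to a unique linear continuous map from $V_bX$ to $C$. 2. $\mathcal C(V_1X)$ is a semitopological cone, and there are linear homeomorphisms $\mathcal C(V_1X)\cong V_bX$ that map $(1,\nu)$ to $\nu$ for every $\nu\in V_1X$ and are natural in $X$ with respect to continuous maps (acting by image valuations). 3. The same statements hold with $V_{b,p}X$ and $V_{1,p}X$ in place of $V_bX$ and $V_1X$. -/

import Mathlib

open scoped NNReal ENNReal unitInterval
open Topology TopologicalSpace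

universe u v w

/-! ### Barycentric algebras and cones

A *cone* is a commutative monoid with an action of the semiring `ℝ≥0`, that is, exactly a
module over the semiring `ℝ≥0`: cones are given by `[AddCommMonoid C] [Module ℝ≥0 C]`, and
linear maps of cones by `C →ₗ[ℝ≥0] D`. -/

/-- A barycentric algebra; `bary a x y` is `x +_a y`. -/
class BarycentricAlgebra (B : Type u) where
  bary : I → B → B → B
  bary_one : ∀ x y : B, bary 1 x y = x
  bary_self : ∀ (a : I) (x : B), bary a x x = x
  bary_symm : ∀ (a : I) (x y : B), bary a x y = bary (unitInterval.symm a) y x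
  bary_assoc : ∀ (a b c : I) (x y z : B), a < 1 → b < 1 →
    (c : ℝ) = (1 - (a : ℝ)) * b / (1 - (a : ℝ) * b) →
    bary b (bary a x y) z = bary (a * b) x (bary c y z)

open BarycentricAlgebra (bary)

/-- Affine maps between barycentric algebras. -/
def IsAffineMap {A : Type u} {B : Type v} [BarycentricAlgebra A] [BarycentricAlgebra B]
    (f : A → B) : Prop :=
  ∀ (a : I) (x y : A), f (bary a x y) = bary a (f x) (f y)

/-- Every convex subset of a cone is a barycentric algebra, with `x +_a y = a x + (1 - a) y`. -/
@[reducible]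
def BarycentricAlgebra.ofConvex {C : Type u} [AddCommMonoid C] [Module ℝ≥0 C] (s : Set C)
    (hs : Convex ℝ≥0 s) : BarycentricAlgebra s where
  bary a x y := ⟨unitInterval.toNNReal a • x.1 + unitInterval.toNNReal (unitInterval.symm a) • y.1,
    hs x.2 y.2 zero_le zero_le (by simp)⟩
  bary_one x y := by simp
  bary_self a x := by
    apply Subtype.ext
    simp [← add_smul]
  bary_symm a x y := by
    apply Subtype.ext
    simp [add_comm]
  bary_assoc a b c x y z ha hb hc := by
    apply Subtype.ext
    have ha' : (a : ℝ) < 1 := ha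
    have hb' : (b : ℝ) < 1 := hb
    have h0 : (0 : ℝ) ≤ a := a.2.1
    have h0' : (0 : ℝ) ≤ b := b.2.1
    have hab : (1 - (a : ℝ) * b) ≠ 0 := by nlinarith
    have h1 : unitInterval.toNNReal b * unitInterval.toNNReal a =
        unitInterval.toNNReal (a * b) := by
      ext
      simp [mul_comm]
    have h2 : unitInterval.toNNReal b * unitInterval.toNNReal (unitInterval.symm a) =
        unitInterval.toNNReal (unitInterval.symm (a * b)) * unitInterval.toNNReal c := by
      ext
      simp [hc]
      rw [mul_div_cancel₀ _ hab, mul_comm]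
    have h3 : unitInterval.toNNReal (unitInterval.symm b) =
        unitInterval.toNNReal (unitInterval.symm (a * b)) *
          unitInterval.toNNReal (unitInterval.symm c) := by
      ext
      simp [hc]
      rw [mul_sub, mul_div_cancel₀ _ hab]
      ring
    simp only [smul_add, smul_smul, ← add_assoc]
    rw [h1, h2, ← h3]

/-- Every cone is a barycentric algebra, with `x +_a y = a x + (1 - a) y`. -/
instance coneBarycentricAlgebra {C : Type u} [AddCommMonoid C] [Module ℝ≥0 C] :
    BarycentricAlgebra C where
  bary a x y := unitInterval.toNNReal a • x + unitInterval.toNNReal (unitInterval.symm a) • y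
  bary_one x y :=
    congrArg Subtype.val ((BarycentricAlgebra.ofConvex (C := C) Set.univ convex_univ).bary_one
      ⟨x, trivial⟩ ⟨y, trivial⟩)
  bary_self a x :=
    congrArg Subtype.val ((BarycentricAlgebra.ofConvex (C := C) Set.univ convex_univ).bary_self
      a ⟨x, trivial⟩)
  bary_symm a x y :=
    congrArg Subtype.val ((BarycentricAlgebra.ofConvex (C := C) Set.univ convex_univ).bary_symm
      a ⟨x, trivial⟩ ⟨y, trivial⟩)
  bary_assoc a b c x y z ha hb hc :=
    congrArg Subtype.val ((BarycentricAlgebra.ofConvex (C := C) Set.univ convex_univ).bary_assoc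
      a b c ⟨x, trivial⟩ ⟨y, trivial⟩ ⟨z, trivial⟩ ha hb hc)

/-- A barycentric algebra with a topology is semitopological if `(x, a, y) ↦ x +_a y` is
separately continuous, `[0, 1]` having its usual metric topology. -/
class SemitopologicalBarycentricAlgebra (B : Type u) [BarycentricAlgebra B]
    [TopologicalSpace B] : Prop where
  continuous_left : ∀ (a : I) (y : B), Continuous fun x : B => bary a x y
  continuous_weight : ∀ x y : B, Continuous fun a : I => bary a x y
  continuous_right : ∀ (a : I) (x : B), Continuous fun y : B => bary a x y

/-- A cone with a topology is semitopological if `+` and `•` are separately continuous, `ℝ≥0`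
having its Scott topology. -/
class SemitopologicalCone (C : Type u) [AddCommMonoid C] [Module ℝ≥0 C]
    [TopologicalSpace C] : Prop where
  continuous_add_left : ∀ y : C, Continuous fun x : C => x + y
  continuous_add_right : ∀ x : C, Continuous fun y : C => x + y
  continuous_scalar : ∀ x : C, Continuous fun a : WithScott ℝ≥0 => WithScott.ofScott a • x
  continuous_smul : ∀ a : ℝ≥0, Continuous fun x : C => a • x

/-- `C`, with `ι : B → C`, is the free cone over the barycentric algebra `B`. -/
def IsFreeCone {B : Type u} {C : Type v} [BarycentricAlgebra B] [AddCommMonoid C]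
    [Module ℝ≥0 C] (ι : B → C) : Prop :=
  IsAffineMap ι ∧
  ∀ (D : Type w) [AddCommMonoid D] [Module ℝ≥0 D] (f : B → D), IsAffineMap f →
    ∃! g : C →ₗ[ℝ≥0] D, ∀ b, g (ι b) = f b

/-- `C`, with `ι : B → C`, is the free semitopological cone over the semitopological
barycentric algebra `B`. -/
def IsFreeSemitopologicalCone {B : Type u} {C : Type v} [BarycentricAlgebra B]
    [TopologicalSpace B] [AddCommMonoid C] [Module ℝ≥0 C] [TopologicalSpace C]
    (ι : B → C) : Prop :=
  SemitopologicalBarycentricAlgebra B ∧ SemitopologicalCone C ∧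
  IsAffineMap ι ∧ Continuous ι ∧
  ∀ (D : Type w) [AddCommMonoid D] [Module ℝ≥0 D] [TopologicalSpace D]
    [SemitopologicalCone D] (f : B → D), IsAffineMap f → Continuous f →
    ∃! g : C →ₗ[ℝ≥0] D, Continuous g ∧ ∀ b, g (ι b) = f b

/-! ### The cone `𝒞(B)` over a barycentric algebra, and its cone topology -/

/-- The elements of `𝒞(B)`: pairs `(r, x)` with `r > 0` and `x ∈ B`, and an extra point `0`. -/
inductive Conify (B : Type u) : Type u
  | zero : Conify B
  | pair (r : {r : ℝ≥0 // 0 < r}) (x : B) : Conify B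

namespace Conify

variable {B : Type u}

instance : Zero (Conify B) := ⟨zero⟩

/-- The canonical map `x ↦ (1, x)`. -/
def eta (x : B) : Conify B := pair ⟨1, one_pos⟩ x

/-- The map `𝒞(f)`, sending `0` to `0` and `(r, x)` to `(r, f x)`. -/
def map {B' : Type v} (f : B → B') : Conify B → Conify B'
  | zero => zero
  | pair r x => pair r (f x)

/-- Multiplication `a • u`, with `a • (r, x) = (a r, x)` if `a ≠ 0`. -/
noncomputable def smul (a : ℝ≥0) : Conify B → Conify B
  | zero => zero
  | pair r x => if h : 0 < a then pair ⟨a * r.1, mul_pos h r.2⟩ x else zero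

noncomputable instance : SMul ℝ≥0 (Conify B) := ⟨smul⟩

lemma zero_def : (zero : Conify B) = 0 := rfl

lemma smul_pair {a : ℝ≥0} (h : 0 < a) (r : {r : ℝ≥0 // 0 < r}) (x : B) :
    a • pair r x = pair ⟨a * r.1, mul_pos h r.2⟩ x := dif_pos h

lemma smul_zero' (a : ℝ≥0) : a • (0 : Conify B) = 0 := rfl

lemma zero_smul' (u : Conify B) : (0 : ℝ≥0) • u = 0 := by
  cases u with
  | zero => rfl
  | pair r x => exact dif_neg (lt_irrefl _)

/-- The weight `r / (r + s)`. -/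
noncomputable def weight (r s : {r : ℝ≥0 // 0 < r}) : I :=
  ⟨((r.1 / (r.1 + s.1) : ℝ≥0) : ℝ), by positivity, by
    have : r.1 / (r.1 + s.1) ≤ 1 := div_le_one_of_le₀ (by simp) zero_le
    exact_mod_cast this⟩

lemma weight_symm (r s : {r : ℝ≥0 // 0 < r}) :
    unitInterval.symm (weight r s) = weight s r := by
  have : (r.1 : ℝ) + s.1 ≠ 0 := by
    have := r.2; have := s.2; positivity
  have h2 : (s.1 : ℝ) + r.1 ≠ 0 := by rwa [add_comm]
  ext
  simp [weight]
  field_simp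
  ring

lemma weight_lt_one (r s : {r : ℝ≥0 // 0 < r}) : weight r s < 1 := by
  have h : r.1 / (r.1 + s.1) < 1 := by
    rw [div_lt_one (add_pos r.2 s.2)]
    exact lt_add_of_pos_right _ s.2
  change ((r.1 / (r.1 + s.1) : ℝ≥0) : ℝ) < 1
  exact_mod_cast h

variable [BarycentricAlgebra B]

/-- Addition, with `(r, x) + (s, y) = (r + s, x +_{r/(r+s)} y)`. -/
noncomputable def add : Conify B → Conify B → Conify B
  | zero, v => v
  | pair r x, zero => pair r x
  | pair r x, pair s y => pair ⟨r.1 + s.1, add_pos r.2 s.2⟩ (bary (weight r s) x y)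

noncomputable instance : Add (Conify B) := ⟨add⟩

lemma pair_add_pair (r s : {r : ℝ≥0 // 0 < r}) (x y : B) :
    pair r x + pair s y = pair ⟨r.1 + s.1, add_pos r.2 s.2⟩ (bary (weight r s) x y) := rfl

lemma zero_add' (u : Conify B) : 0 + u = u := rfl

lemma add_zero' (u : Conify B) : u + 0 = u := by cases u <;> rfl

lemma add_comm' (u v : Conify B) : u + v = v + u := by
  cases u with
  | zero => exact (add_zero' v).symm
  | pair r x =>
    cases v with
    | zero => rfl
    | pair s y =>
      rw [pair_add_pair, pair_add_pair, BarycentricAlgebra.bary_symm, weight_symm]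
      congr 1
      exact Subtype.ext (add_comm _ _)

lemma add_assoc' (u v t : Conify B) : u + v + t = u + (v + t) := by
  cases u with
  | zero => rfl
  | pair r x =>
    cases v with
    | zero => rfl
    | pair s y =>
      cases t with
      | zero => rfl
      | pair t z =>
        simp only [pair_add_pair]
        have hr : (0 : ℝ) < r.1 := r.2
        have hs : (0 : ℝ) < s.1 := s.2
        have ht : (0 : ℝ) < t.1 := t.2
        rw [BarycentricAlgebra.bary_assoc _ _ (weight s t) _ _ _ (weight_lt_one _ _)
          (weight_lt_one _ _)]
        · congr 1
          · exact Subtype.ext (add_assoc _ _ _)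
          · congr 1
            ext
            simp [weight]
            field_simp
            ring
        · simp [weight]
          have h1 : (r.1 : ℝ) + s.1 ≠ 0 := by positivity
          have h2 : (s.1 : ℝ) + t.1 ≠ 0 := by positivity
          have h3 : (r.1 : ℝ) + s.1 + t.1 ≠ 0 := by positivity
          have h4 : 1 - (r.1 : ℝ) / (r.1 + s.1) * ((r.1 + s.1) / (r.1 + s.1 + t.1))
              = (s.1 + t.1) / (r.1 + s.1 + t.1) := by
            field_simp
            ring
          rw [h4]
          field_simp
          ring

noncomputable instance : AddCommMonoid (Conify B) where
  add_assoc := add_assoc'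
  zero_add := zero_add'
  add_zero := add_zero'
  add_comm := add_comm'
  nsmul := nsmulRec

noncomputable instance : Module ℝ≥0 (Conify B) where
  one_smul u := by
    cases u with
    | zero => rfl
    | pair r x => rw [smul_pair one_pos]; congr 1; exact Subtype.ext (one_mul _)
  mul_smul a b u := by
    rcases eq_or_lt_of_le (zero_le (a := a)) with rfl | ha
    · rw [zero_mul, zero_smul', zero_smul']
    rcases eq_or_lt_of_le (zero_le (a := b)) with rfl | hb
    · rw [mul_zero, zero_smul', smul_zero']
    cases u with
    | zero => rfl
    | pair r x =>
      rw [smul_pair hb, smul_pair ha, smul_pair (mul_pos ha hb)]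
      congr 1; exact Subtype.ext (mul_assoc _ _ _)
  smul_zero := smul_zero'
  smul_add a u v := by
    rcases eq_or_lt_of_le (zero_le (a := a)) with rfl | ha
    · simp only [zero_smul']; rfl
    cases u with
    | zero => rfl
    | pair r x =>
      cases v with
      | zero => rw [zero_def, smul_zero', add_zero', add_zero']
      | pair s y =>
        rw [pair_add_pair, smul_pair ha, smul_pair ha, smul_pair ha, pair_add_pair]
        have hr : (0 : ℝ) < r.1 := r.2
        have hs : (0 : ℝ) < s.1 := s.2
        have ha' : (0 : ℝ) < a := ha
        congr 1
        · exact Subtype.ext (mul_add _ _ _)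
        · congr 1
          ext
          simp [weight]
          field_simp
  add_smul a b u := by
    rcases eq_or_lt_of_le (zero_le (a := a)) with rfl | ha
    · rw [zero_add, zero_smul', zero_add']
    rcases eq_or_lt_of_le (zero_le (a := b)) with rfl | hb
    · rw [add_zero, zero_smul', add_zero']
    cases u with
    | zero => rfl
    | pair r x =>
      rw [smul_pair ha, smul_pair hb, smul_pair (add_pos ha hb), pair_add_pair,
        BarycentricAlgebra.bary_self]
      congr 1; exact Subtype.ext (add_mul _ _ _)
  zero_smul := zero_smul'

variable [TopologicalSpace B]

/-- The preordering of `𝒞(B)`, where `B` is preordered by its specialization preordering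
(`y₁ ≤ y` if and only if every open neighborhood of `y₁` contains `y`). -/
def LE (u v : Conify B) : Prop :=
  (u = 0 ∧ v = 0) ∨
  ∃ s y, v = pair s y ∧ ∃ (u' : Conify B) (y₁ : B), u + u' = pair s y₁ ∧
    ∀ U : Set B, IsOpen U → y₁ ∈ U → y ∈ U

/-- The cone topology: it has as subbase the open subsets of `(ℝ≥0 \ {0}) × B` that are
upwards-closed in `𝒞(B)`, where `ℝ≥0 \ {0}` has its Scott topology. -/
instance : TopologicalSpace (Conify B) :=
  generateFrom {W | 0 ∉ W ∧
    IsOpen {p : WithScott {r : ℝ≥0 // 0 < r} × B | pair (WithScott.ofScott p.1) p.2 ∈ W} ∧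
    ∀ u v, LE u v → u ∈ W → v ∈ W}

end Conify

/-! ### Continuous valuations -/

/-- Continuous valuations: strict, modular, Scott-continuous maps from the open sets to
`[0, ∞]`. -/
@[ext]
structure ContinuousValuation (X : Type u) [TopologicalSpace X] where
  toFun : Opens X → ℝ≥0∞
  strict : toFun ⊥ = 0
  modular : ∀ U V : Opens X, toFun U + toFun V = toFun (U ⊔ V) + toFun (U ⊓ V)
  scottContinuous : ScottContinuous toFun

namespace ContinuousValuation

variable {X : Type u} [TopologicalSpace X]

instance : CoeFun (ContinuousValuation X) fun _ => Opens X → ℝ≥0∞ := ⟨toFun⟩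

lemma toFun_injective : Function.Injective (toFun : ContinuousValuation X → _) :=
  fun _ _ h => ContinuousValuation.ext h

lemma scottContinuous_add {f g : Opens X → ℝ≥0∞} (hf : ScottContinuous f)
    (hg : ScottContinuous g) : ScottContinuous (f + g) := by
  intro d hd hdir a ha
  have h1 : f a = ⨆ i : d, f i := by rw [← (hf hd hdir ha).sSup_eq, sSup_image']
  have h2 : g a = ⨆ i : d, g i := by rw [← (hg hd hdir ha).sSup_eq, sSup_image']
  have : (f + g) a = sSup ((f + g) '' d) := by
    rw [sSup_image', Pi.add_apply, h1, h2, ENNReal.iSup_add_iSup]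
    · rfl
    · intro i j
      obtain ⟨k, hk, hik, hjk⟩ := hdir i i.2 j j.2
      exact ⟨⟨k, hk⟩, add_le_add (hf.monotone hik) (hg.monotone hjk)⟩
  rw [this]
  exact isLUB_sSup _

lemma scottContinuous_smul {f : Opens X → ℝ≥0∞} (c : ℝ≥0) (hf : ScottContinuous f) :
    ScottContinuous (c • f) := by
  intro d hd hdir a ha
  have h1 : f a = ⨆ i : d, f i := by rw [← (hf hd hdir ha).sSup_eq, sSup_image']
  have : (c • f) a = sSup ((c • f) '' d) := by
    rw [sSup_image', Pi.smul_apply, h1, ENNReal.smul_def, smul_eq_mul, ENNReal.mul_iSup]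
    rfl
  rw [this]
  exact isLUB_sSup _

/-- The zero valuation. -/
instance : Zero (ContinuousValuation X) :=
  ⟨{ toFun := 0
     strict := rfl
     modular := by simp
     scottContinuous := by
      intro d hd _ a _
      have : (0 : Opens X → ℝ≥0∞) '' d = {0} := hd.image_const 0
      rw [this]
      exact isLUB_singleton }⟩

/-- Pointwise addition. -/
instance : Add (ContinuousValuation X) :=
  ⟨fun μ ν =>
   { toFun := μ.toFun + ν.toFun
     strict := by simp [μ.strict, ν.strict]
     modular := fun U V => by
      simp only [Pi.add_apply]
      rw [add_add_add_comm, μ.modular, ν.modular, add_add_add_comm]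
     scottContinuous := scottContinuous_add μ.scottContinuous ν.scottContinuous }⟩

/-- Pointwise multiplication by a scalar. -/
noncomputable instance : SMul ℝ≥0 (ContinuousValuation X) :=
  ⟨fun a ν =>
   { toFun := a • ν.toFun
     strict := by simp [ν.strict]
     modular := fun U V => by
      simp only [Pi.smul_apply]
      rw [← smul_add, ν.modular, smul_add]
     scottContinuous := scottContinuous_smul a ν.scottContinuous }⟩

lemma zero_apply (U : Opens X) : (0 : ContinuousValuation X) U = 0 := rfl
lemma add_apply (μ ν : ContinuousValuation X) (U : Opens X) : (μ + ν) U = μ U + ν U := rfl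
lemma smul_apply (a : ℝ≥0) (ν : ContinuousValuation X) (U : Opens X) :
    (a • ν) U = (a : ℝ≥0∞) * ν U := rfl

instance : AddCommMonoid (ContinuousValuation X) where
  add_assoc μ ν ρ := toFun_injective (add_assoc μ.toFun ν.toFun ρ.toFun)
  zero_add μ := toFun_injective (zero_add μ.toFun)
  add_zero μ := toFun_injective (add_zero μ.toFun)
  add_comm μ ν := toFun_injective (add_comm μ.toFun ν.toFun)
  nsmul := nsmulRec

noncomputable instance : Module ℝ≥0 (ContinuousValuation X) where
  one_smul μ := toFun_injective (one_smul ℝ≥0 μ.toFun)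
  mul_smul a b μ := toFun_injective (mul_smul a b μ.toFun)
  smul_zero a := toFun_injective (smul_zero (A := Opens X → ℝ≥0∞) a)
  smul_add a μ ν := toFun_injective (smul_add a μ.toFun ν.toFun)
  add_smul a b μ := toFun_injective (add_smul a b μ.toFun)
  zero_smul μ := toFun_injective (zero_smul ℝ≥0 μ.toFun)

/-- The weak topology, with subbasic open sets `[U > r] = {ν | ν U > r}`, `r > 0`. -/
instance : TopologicalSpace (ContinuousValuation X) :=
  generateFrom {W | ∃ (U : Opens X) (r : ℝ≥0), 0 < r ∧ W = {ν | (r : ℝ≥0∞) < ν U}}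

/-- The image valuation `V ↦ ν (g⁻¹ V)` of `ν` by a continuous map `g`. -/
def map {Y : Type v} [TopologicalSpace Y] (g : C(X, Y)) (ν : ContinuousValuation X) :
    ContinuousValuation Y where
  toFun V := ν (Opens.comap g V)
  strict := by rw [map_bot]; exact ν.strict
  modular U V := by rw [ν.modular, map_sup, map_inf]
  scottContinuous := by
    intro d hd hdir a ha
    have h : IsLUB (Opens.comap g '' d) (Opens.comap g a) := by
      rw [← ha.sSup_eq, map_sSup]
      exact isLUB_sSup _
    have := ν.scottContinuous (hd.image _)
      (hdir.mono_comp (fun _ _ hUV => Opens.comap_mono g hUV)) h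
    rwa [Set.image_image] at this

/-- The pointwise topology on the set of open subsets of `X`, with subbasic open sets
`{U | x ∈ U}`. -/
@[reducible]
def pointwiseTopology (X : Type u) [TopologicalSpace X] : TopologicalSpace (Opens X) :=
  generateFrom {W | ∃ x : X, W = {U : Opens X | x ∈ U}}

/-- Point-continuous valuations: continuous from the open sets with the pointwise topology to
`[0, ∞]` with its Scott topology. -/
def IsPointContinuous (ν : ContinuousValuation X) : Prop :=
  Continuous[pointwiseTopology X, _] fun U : Opens X => WithScott.toScott (ν U)

lemma continuous_toScott_iff {Z : Type v} [TopologicalSpace Z] {f : Z → ℝ≥0∞} :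
    Continuous (fun z => WithScott.toScott (f z)) ↔ LowerSemicontinuous f := by
  have h : (inferInstance : TopologicalSpace (WithScott ℝ≥0∞)) = upper ℝ≥0∞ :=
    IsScott.scott_eq_upper_of_completeLinearOrder (α := ℝ≥0∞)
  have : IsUpper (WithScott ℝ≥0∞) := ⟨h⟩
  rw [IsUpper.continuous_iff_Iic, lowerSemicontinuous_iff_isClosed_preimage]
  exact Iff.rfl

lemma isPointContinuous_iff (ν : ContinuousValuation X) :
    IsPointContinuous ν ↔ @LowerSemicontinuous _ _ (pointwiseTopology X) _ ν.toFun :=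
  @continuous_toScott_iff (Opens X) (pointwiseTopology X) ν.toFun

lemma IsPointContinuous.add {μ ν : ContinuousValuation X} (hμ : IsPointContinuous μ)
    (hν : IsPointContinuous ν) : IsPointContinuous (μ + ν) := by
  rw [isPointContinuous_iff] at hμ hν ⊢
  let _ := pointwiseTopology X
  exact LowerSemicontinuous.add hμ hν

lemma IsPointContinuous.zero : IsPointContinuous (0 : ContinuousValuation X) := by
  let _ := pointwiseTopology X
  exact continuous_const

lemma IsPointContinuous.smul {ν : ContinuousValuation X} (a : ℝ≥0)
    (hν : IsPointContinuous ν) : IsPointContinuous (a • ν) := by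
  rw [isPointContinuous_iff] at hν ⊢
  let _ := pointwiseTopology X
  exact (ENNReal.continuous_const_mul ENNReal.coe_ne_top).comp_lowerSemicontinuous hν
    (fun _ _ h => mul_le_mul_right h _)

lemma IsPointContinuous.map {Y : Type v} [TopologicalSpace Y] {ν : ContinuousValuation X}
    (hν : IsPointContinuous ν) (g : C(X, Y)) : IsPointContinuous (ν.map g) := by
  have h : Continuous[pointwiseTopology Y, pointwiseTopology X] (Opens.comap g) := by
    let _ := pointwiseTopology X
    let _ := pointwiseTopology Y
    refine continuous_generateFrom_iff.2 ?_
    rintro _ ⟨x, rfl⟩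
    exact isOpen_generateFrom_of_mem ⟨g x, rfl⟩
  exact @Continuous.comp _ _ _ (pointwiseTopology Y) (pointwiseTopology X) _ _ _ hν h

/-- The bounded continuous valuations, `ν X < ∞`. -/
def bounded (X : Type u) [TopologicalSpace X] : Submodule ℝ≥0 (ContinuousValuation X) where
  carrier := {ν | ν ⊤ < ∞}
  add_mem' hμ hν := ENNReal.add_lt_top.2 ⟨hμ, hν⟩
  zero_mem' := ENNReal.zero_lt_top
  smul_mem' _ _ hν := ENNReal.mul_lt_top ENNReal.coe_lt_top hν

/-- The point-continuous valuations. -/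
def pointContinuous (X : Type u) [TopologicalSpace X] :
    Submodule ℝ≥0 (ContinuousValuation X) where
  carrier := {ν | IsPointContinuous ν}
  add_mem' hμ hν := hμ.add hν
  zero_mem' := IsPointContinuous.zero
  smul_mem' a _ hν := hν.smul a

/-- The probability valuations, `ν X = 1`. -/
def probability (X : Type u) [TopologicalSpace X] : Set (ContinuousValuation X) :=
  {ν | ν ⊤ = 1}

lemma convex_probability : Convex ℝ≥0 (probability X) := by
  intro μ hμ ν hν a b _ _ hab
  have hμ' : μ ⊤ = 1 := hμ
  have hν' : ν ⊤ = 1 := hν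
  change (a : ℝ≥0∞) * μ ⊤ + (b : ℝ≥0∞) * ν ⊤ = 1
  rw [hμ', hν', mul_one, mul_one]
  exact_mod_cast hab

end ContinuousValuation

open ContinuousValuation

/-- `V_b X`, the cone of bounded continuous valuations, with the weak topology. -/
abbrev Vb (X : Type u) [TopologicalSpace X] : Type u := bounded X

/-- `V_1 X`, the space of probability continuous valuations, with the weak topology. -/
abbrev V1 (X : Type u) [TopologicalSpace X] : Type u := probability X

/-- `V_{b,p} X`, the cone of bounded point-continuous valuations, with the weak topology. -/
abbrev Vbp (X : Type u) [TopologicalSpace X] : Type u :=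
  (bounded X ⊓ pointContinuous X : Submodule ℝ≥0 (ContinuousValuation X))

/-- `V_{1,p} X`, the space of point-continuous probability valuations, with the weak topology. -/
abbrev V1p (X : Type u) [TopologicalSpace X] : Type u :=
  (probability X ∩ pointContinuous X : Set (ContinuousValuation X))

noncomputable instance (X : Type u) [TopologicalSpace X] : BarycentricAlgebra (V1 X) :=
  BarycentricAlgebra.ofConvex (probability X) convex_probability

noncomputable instance (X : Type u) [TopologicalSpace X] : BarycentricAlgebra (V1p X) :=
  BarycentricAlgebra.ofConvex (probability X ∩ pointContinuous X)
    (convex_probability.inter fun _ hμ _ hν a b _ _ _ =>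
      (pointContinuous X).add_mem ((pointContinuous X).smul_mem a hμ)
        ((pointContinuous X).smul_mem b hν))

section Maps

variable {X : Type u} [TopologicalSpace X] {Y : Type v} [TopologicalSpace Y]

lemma probability_subset_bounded {ν : ContinuousValuation X} (h : ν ∈ probability X) :
    ν ∈ bounded X :=
  lt_of_eq_of_lt h ENNReal.one_lt_top

/-- The inclusion of `V_1 X` in `V_b X`. -/
def V1.incl (ν : V1 X) : Vb X := ⟨ν.1, probability_subset_bounded ν.2⟩

/-- The inclusion of `V_{1,p} X` in `V_{b,p} X`. -/
def V1p.incl (ν : V1p X) : Vbp X := ⟨ν.1, probability_subset_bounded ν.2.1, ν.2.2⟩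

/-- The action of `V_b` on continuous maps, by image valuations. -/
def Vb.map (g : C(X, Y)) (ν : Vb X) : Vb Y := ⟨ν.1.map g, ν.2⟩

/-- The action of `V_1` on continuous maps, by image valuations. -/
def V1.map (g : C(X, Y)) (ν : V1 X) : V1 Y := ⟨ν.1.map g, ν.2⟩

/-- The action of `V_{b,p}` on continuous maps, by image valuations. -/
def Vbp.map (g : C(X, Y)) (ν : Vbp X) : Vbp Y := ⟨ν.1.map g, ν.2.1, ν.2.2.map g⟩

/-- The action of `V_{1,p}` on continuous maps, by image valuations. -/
def V1p.map (g : C(X, Y)) (ν : V1p X) : V1p Y := ⟨ν.1.map g, ν.2.1, ν.2.2.map g⟩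

end Maps

/-! The map `(r, ν) ↦ r • ν` from `𝒞(V₁X)` to `V_bX` is linear, and dividing a nonzero bounded
valuation by its mass inverts it. Over any barycentric algebra `B`, the cone `𝒞(B)` is free: an
affine map `f` can only extend by `(r, x) ↦ r • f x`, and this extension is continuous if `f` is and
the target cone is semitopological (`lift`, `continuous_lift`). So everything reduces to showing
that the bijection is a homeomorphism. It is continuous, being the extension of the inclusion; the
substance is the continuity of its inverse (`continuous_linearEquiv_symm`).

Let `(r, x)` lie in a subbasic open set `W` of `𝒞(V₁X)`. Some `(s, x)` with `s < r` is still in `W`,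
and so is `(s, y)` for every `y` in `V₁X` that dominates `x` on a suitable finite set of open sets,
which may be enlarged to a finite lattice `L`. Every `ν` close to `r • x` dominates `s • x` on `L`.
As `W` is upwards-closed, it suffices that `ν` have a summand of mass exactly `s` that still
dominates `s • x` on `L`: this is `exists_summand`.

That summand is obtained by trimming `ν`. Given `T` in `L` on which `ν` and `s • x` agree, the part
of `ν` outside `T` is scaled down until equality occurs at a further member of `L`; modularity then
gives equality at the join, and the process ends at the whole space. It only uses restrictions to
open sets and to their complements, sums and scalar multiples. All of these preserve
point-continuity, so one proof serves both families of valuations. -/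

section Scott

/-! ### Scott topologies on chains -/

lemma isOpen_withScott_lt {α : Type*} [LinearOrder α] (s : α) :
    IsOpen {a : WithScott α | s < WithScott.ofScott a} := by
  have h : IsClosed (Set.Iic (WithScott.toScott s)) := isClosed_Iic
  convert h.isOpen_compl using 1
  ext a
  exact not_le.symm

/-- By density `r` is the supremum of the elements strictly below it. These must exist, because
Scott-openness only concerns suprema of nonempty directed sets. -/
lemma exists_lt_mem_of_isOpen_withScott {α : Type*} [LinearOrder α] [DenselyOrdered α]
    {O : Set (WithScott α)} (hO : IsOpen O) {r : α} (hr : WithScott.toScott r ∈ O)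
    (hmin : (Set.Iio r).Nonempty) : ∃ s < r, WithScott.toScott s ∈ O := by
  have hlub : IsLUB (Set.Iio r) r := by
    refine ⟨fun s hs => le_of_lt hs, fun b hb => ?_⟩
    by_contra! hbr
    obtain ⟨c, hbc, hcr⟩ := exists_between hbr
    exact absurd (hb hcr) (not_le.2 hbc)
  have hdir : DirectedOn (· ≤ ·) (Set.Iio r) := fun a ha b hb =>
    ⟨max a b, max_lt ha hb, le_max_left _ _, le_max_right _ _⟩
  obtain ⟨s, hs, hsO⟩ :=
    (IsScott.isOpen_iff_isUpperSet_and_dirSupInaccOn (D := Set.univ).1 hO).2 trivial hmin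
      hdir hlub hr
  exact ⟨s, hs, hsO⟩

lemma mem_of_isOpen_withScott_of_le {α : Type*} [Preorder α]
    {O : Set (WithScott α)} (hO : IsOpen O) {r s : α} (hr : WithScott.toScott r ∈ O)
    (hrs : r ≤ s) : WithScott.toScott s ∈ O :=
  IsScott.isUpperSet_of_isOpen (D := Set.univ) hO hrs hr

end Scott

/-! ### Open sets of semitopological cones -/

namespace SemitopologicalCone

variable {D : Type*} [AddCommMonoid D] [Module ℝ≥0 D] [TopologicalSpace D]
  [SemitopologicalCone D] {O : Set D}

lemma smul_mem_of_isOpen (hO : IsOpen O) {z : D} {r s : ℝ≥0} (h : r • z ∈ O) (hrs : r ≤ s) :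
    s • z ∈ O :=
  mem_of_isOpen_withScott_of_le (hO.preimage (continuous_scalar z)) (r := r) h hrs

/-- The scalars `a` with `z + a • t ∈ O` form a Scott-open, hence upwards-closed, set; it contains
`0`, hence also `1`. -/
lemma add_mem_of_isOpen (hO : IsOpen O) {z : D} (h : z ∈ O) (t : D) : z + t ∈ O := by
  have := smul_mem_of_isOpen (O := (fun y => z + y) ⁻¹' O) (hO.preimage (continuous_add_right z))
    (z := t) (r := 0) (s := 1) (by simpa using h) zero_le_one
  simpa using this

lemma eq_univ_of_isOpen (hO : IsOpen O) (h : (0 : D) ∈ O) : O = Set.univ :=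
  Set.eq_univ_of_forall fun z => by simpa using add_mem_of_isOpen hO h z

lemma exists_lt_smul_mem_of_isOpen (hO : IsOpen O) {z : D} {r : ℝ≥0} (hr : 0 < r)
    (h : r • z ∈ O) : ∃ s < r, s • z ∈ O :=
  exists_lt_mem_of_isOpen_withScott (hO.preimage (continuous_scalar z)) (r := r) h ⟨0, hr⟩

end SemitopologicalCone

/-! ### Freeness of `𝒞(B)` and its transport along isomorphisms -/

namespace Conify

lemma pair_eq_smul_eta {B : Type*} (r : {r : ℝ≥0 // 0 < r}) (x : B) : pair r x = r.1 • eta x := by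
  rw [eta, smul_pair r.2]
  congr 1
  exact Subtype.ext (mul_one _).symm

section Lift

variable {B : Type u} [BarycentricAlgebra B] {D : Type v} [AddCommMonoid D] [Module ℝ≥0 D]

lemma toNNReal_weight (r s : {r : ℝ≥0 // 0 < r}) :
    unitInterval.toNNReal (weight r s) = r.1 / (r.1 + s.1) := rfl

/-- The linear map on `𝒞(B)` that extends an affine map on `B`. -/
def lift (f : B → D) (hf : IsAffineMap f) : Conify B →ₗ[ℝ≥0] D where
  toFun
    | zero => 0
    | pair r x => r.1 • f x
  map_add' u v := by
    cases u with
    | zero => exact (zero_add _).symm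
    | pair r x =>
      cases v with
      | zero => exact (add_zero _).symm
      | pair s y =>
        have h : r.1 + s.1 ≠ 0 := (add_pos r.2 s.2).ne'
        rw [pair_add_pair]
        change (r.1 + s.1) • f (bary (weight r s) x y) = r.1 • f x + s.1 • f y
        rw [hf]
        change (r.1 + s.1) • (unitInterval.toNNReal (weight r s) • f x +
          unitInterval.toNNReal (unitInterval.symm (weight r s)) • f y) = _
        rw [weight_symm, toNNReal_weight, toNNReal_weight, smul_add, smul_smul, smul_smul,
          add_comm s.1, mul_div_cancel₀ _ h, mul_div_cancel₀ _ h]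
  map_smul' a u := by
    cases u with
    | zero => exact (smul_zero a).symm
    | pair r x =>
      rcases eq_or_lt_of_le (zero_le (a := a)) with rfl | ha
      · rw [zero_smul, RingHom.id_apply, zero_smul]
      · rw [smul_pair ha]
        exact mul_smul a r.1 (f x)

variable {f : B → D} {hf : IsAffineMap f}

lemma lift_eta (x : B) : lift f hf (eta x) = f x := one_smul _ _

lemma linearMap_ext {g h : Conify B →ₗ[ℝ≥0] D} (H : ∀ x, g (eta x) = h (eta x)) : g = h := by
  ext u
  cases u with
  | zero => exact g.map_zero.trans h.map_zero.symm
  | pair r x => rw [pair_eq_smul_eta, map_smul, map_smul, H]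

lemma continuous_lift [TopologicalSpace B] [TopologicalSpace D] [SemitopologicalCone D]
    (hc : Continuous f) : Continuous (lift f hf) := by
  refine continuous_def.2 fun O hO => ?_
  -- The subbasic sets of the cone topology omit `0`, so an open set containing `0` is treated
  -- apart: it is the whole cone.
  by_cases h0 : (0 : D) ∈ O
  · rw [SemitopologicalCone.eq_univ_of_isOpen hO h0]
    exact isOpen_univ
  refine isOpen_generateFrom_of_mem ⟨h0, ?_, ?_⟩
  · refine isOpen_iff_forall_mem_open.2 ?_
    rintro ⟨r, x⟩ (hrx : (WithScott.ofScott r).1 • f x ∈ O)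
    obtain ⟨s, hsr, hs⟩ := SemitopologicalCone.exists_lt_smul_mem_of_isOpen hO
      (WithScott.ofScott r).2 hrx
    have hs0 : 0 < s := by
      refine pos_iff_ne_zero.2 ?_
      rintro rfl
      exact h0 (by simpa using hs)
    -- Scalar multiplication is only separately continuous. Lowering `r` to a fixed `s` gives a
    -- product neighborhood: `s • f y ∈ O` implies `a • f y ∈ O` for all `a ≥ s`.
    refine ⟨{a | (⟨s, hs0⟩ : {r : ℝ≥0 // 0 < r}) < WithScott.ofScott a} ×ˢ
      ((fun y => s • f y) ⁻¹' O), ?_, ?_, ?_⟩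
    · rintro ⟨a, y⟩ ⟨ha, hy⟩
      exact SemitopologicalCone.smul_mem_of_isOpen hO hy 
        (show s ≤ (WithScott.ofScott a).1 from le_of_lt ha)
    · exact (isOpen_withScott_lt _).prod
        (hO.preimage ((SemitopologicalCone.continuous_smul s).comp hc))
    · exact ⟨hsr, hs⟩
  · rintro u v (⟨rfl, rfl⟩ | ⟨s, y, rfl, u', y₁, huu', hy⟩) hu
    · exact hu
    · have h1 := SemitopologicalCone.add_mem_of_isOpen hO hu (lift f hf u')
      rw [← map_add, huu'] at h1
      exact hy _ (hO.preimage ((SemitopologicalCone.continuous_smul s.1).comp hc)) h1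

end Lift

section Transport

variable {B : Type u} [BarycentricAlgebra B] {C : Type v} [AddCommMonoid C] [Module ℝ≥0 C]
  {ι : B → C}

lemma isFreeCone_of_linearEquiv (hι : IsAffineMap ι) (e : Conify B ≃ₗ[ℝ≥0] C)
    (he : ∀ b, e (eta b) = ι b) : IsFreeCone.{u, v, w} ι := by
  refine ⟨hι, fun D _ _ f hf => ⟨(lift f hf).comp e.symm.toLinearMap, fun b => ?_, ?_⟩⟩
  · rw [← he]
    simp [lift_eta]
  · intro g hg
    have : g.comp e.toLinearMap = lift f hf :=
      linearMap_ext fun x => by simp [he, hg, lift_eta]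
    rw [← this]
    ext c
    simp

lemma isFreeSemitopologicalCone_of_continuousLinearEquiv [TopologicalSpace B]
    [TopologicalSpace C] [SemitopologicalBarycentricAlgebra B] [SemitopologicalCone C]
    (hι : IsAffineMap ι) (hc : Continuous ι) (e : Conify B ≃L[ℝ≥0] C)
    (he : ∀ b, e (eta b) = ι b) : IsFreeSemitopologicalCone.{u, v, w} ι := by
  refine ⟨inferInstance, inferInstance, hι, hc, fun D _ _ _ _ f hf hfc => ?_⟩
  obtain ⟨g, hg, huniq⟩ := (isFreeCone_of_linearEquiv.{u, v, w} hι e.toLinearEquiv he).2 D f hf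
  have hge : g.comp e.toLinearEquiv.toLinearMap = lift f hf :=
    linearMap_ext fun x => by
      rw [lift_eta, ← hg, ← he]
      rfl
  refine ⟨g, ⟨?_, hg⟩, fun g' hg' => huniq g' hg'.2⟩
  have : (g : C → D) = lift f hf ∘ e.symm := by
    ext c
    rw [← hge]
    exact congrArg g (e.apply_symm_apply c).symm
  rw [this]
  exact (continuous_lift hfc).comp e.symm.continuous

end Transport

end Conify

lemma SemitopologicalCone.of_continuousLinearEquiv {C : Type u} {D : Type v} [AddCommMonoid C]
    [Module ℝ≥0 C] [TopologicalSpace C] [AddCommMonoid D] [Module ℝ≥0 D] [TopologicalSpace D]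
    [SemitopologicalCone D] (e : C ≃L[ℝ≥0] D) : SemitopologicalCone C where
  continuous_add_left y := by
    have := e.symm.continuous.comp ((continuous_add_left (e y)).comp e.continuous)
    convert this using 2 with x
    simp
  continuous_add_right x := by
    have := e.symm.continuous.comp ((continuous_add_right (e x)).comp e.continuous)
    convert this using 2 with y
    simp
  continuous_scalar x := by
    have := e.symm.continuous.comp (continuous_scalar (e x))
    convert this using 2 with a
    simp
  continuous_smul a := by
    have := e.symm.continuous.comp ((continuous_smul a).comp e.continuous)
    convert this using 2 with x
    simp

/-! ### Restrictions of valuations, and summands of prescribed mass -/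

namespace ContinuousValuation

variable {X : Type u} [TopologicalSpace X]

lemma mono (ν : ContinuousValuation X) {U V : Opens X} (h : U ≤ V) : ν U ≤ ν V :=
  ν.scottContinuous.monotone h

lemma lt_top_of_mem_bounded {ν : ContinuousValuation X} (h : ν ∈ bounded X) (U : Opens X) :
    ν U < ∞ :=
  (ν.mono le_top).trans_lt h

lemma scottContinuous_inf_right (T : Opens X) : ScottContinuous fun U : Opens X => U ⊓ T := by
  intro d _ _ a ha
  change IsLUB _ (a ⊓ T)
  rw [← ha.sSup_eq, sSup_inf_eq, ← sSup_image]
  exact isLUB_sSup _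

lemma scottContinuous_sup_right (T : Opens X) : ScottContinuous fun U : Opens X => U ⊔ T := by
  intro d hd _ a ha
  refine ⟨?_, fun b hb => ?_⟩
  · rintro _ ⟨U, hU, rfl⟩
    exact sup_le_sup_right (ha.1 hU) T
  · obtain ⟨U, hU⟩ := hd
    exact sup_le (ha.2 fun V hV => le_sup_left.trans (hb ⟨V, hV, rfl⟩))
      (le_sup_right.trans (hb ⟨U, hU, rfl⟩))

lemma scottContinuous_tsub_right (c : ℝ≥0∞) : ScottContinuous fun x : ℝ≥0∞ => x - c := by
  intro d _ _ a ha
  change IsLUB _ (a - c)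
  rw [← ha.sSup_eq, sSup_eq_iSup', ENNReal.iSup_sub, ← sSup_image' (s := d) (f := fun x => x - c)]
  exact isLUB_sSup _

/-- The restriction `U ↦ ν (U ∩ T)` of a continuous valuation to an open set `T`. -/
def restrict (ν : ContinuousValuation X) (T : Opens X) : ContinuousValuation X where
  toFun U := ν (U ⊓ T)
  strict := by rw [bot_inf_eq, ν.strict]
  modular U V := by rw [ν.modular, ← inf_sup_right, ← inf_inf_distrib_right]
  scottContinuous := (scottContinuous_inf_right T).comp ν.scottContinuous

/-- The restriction `U ↦ ν (U ∪ T) - ν T` of a bounded continuous valuation to the complement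
of an open set `T`. -/
noncomputable def restrictCompl (ν : ContinuousValuation X) (hν : ν ∈ bounded X) (T : Opens X) :
    ContinuousValuation X where
  toFun U := ν (U ⊔ T) - ν T
  strict := by rw [bot_sup_eq, tsub_self]
  modular U V := by
    have hT : ν T ≠ ∞ := (lt_top_of_mem_bounded hν T).ne
    -- To avoid truncated subtraction, each value is written as `ν T` plus a remainder; `ν T` is
    -- finite and cancels twice.
    obtain ⟨a, ha⟩ := exists_add_of_le (ν.mono (le_sup_right : T ≤ U ⊔ T))
    obtain ⟨b, hb⟩ := exists_add_of_le (ν.mono (le_sup_right : T ≤ V ⊔ T))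
    obtain ⟨c, hc⟩ := exists_add_of_le (ν.mono (le_sup_right : T ≤ U ⊔ V ⊔ T))
    obtain ⟨d, hd⟩ := exists_add_of_le (ν.mono (le_sup_right : T ≤ U ⊓ V ⊔ T))
    have h := ν.modular (U ⊔ T) (V ⊔ T)
    rw [← sup_sup_distrib_right, ← sup_inf_right, ha, hb, hc, hd, add_add_add_comm,
      add_add_add_comm (ν T) c] at h
    rw [ha, hb, hc, hd, ENNReal.add_sub_cancel_left hT, ENNReal.add_sub_cancel_left hT,
      ENNReal.add_sub_cancel_left hT, ENNReal.add_sub_cancel_left hT]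
    exact (ENNReal.add_right_inj (ENNReal.add_ne_top.2 ⟨hT, hT⟩)).1 h
  scottContinuous := ((scottContinuous_sup_right T).comp ν.scottContinuous).comp
    (scottContinuous_tsub_right (ν T))

lemma restrict_apply (ν : ContinuousValuation X) (T U : Opens X) :
    ν.restrict T U = ν (U ⊓ T) := rfl

lemma restrictCompl_apply (ν : ContinuousValuation X) (hν : ν ∈ bounded X) (T U : Opens X) :
    ν.restrictCompl hν T U = ν (U ⊔ T) - ν T := rfl

lemma restrict_add_restrictCompl (ν : ContinuousValuation X) (hν : ν ∈ bounded X)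
    (T : Opens X) : ν.restrict T + ν.restrictCompl hν T = ν := by
  ext U
  have hT : ν T ≠ ∞ := (lt_top_of_mem_bounded hν T).ne
  rw [add_apply, restrict_apply, restrictCompl_apply]
  refine (ENNReal.add_left_inj hT).1 ?_
  rw [add_assoc, tsub_add_cancel_of_le (ν.mono le_sup_right), add_comm, ← ν.modular]

lemma restrict_mem_bounded {ν : ContinuousValuation X} (hν : ν ∈ bounded X) (T : Opens X) :
    ν.restrict T ∈ bounded X :=
  lt_top_of_mem_bounded hν _

lemma restrictCompl_mem_bounded {ν : ContinuousValuation X} (hν : ν ∈ bounded X)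
    (T : Opens X) : ν.restrictCompl hν T ∈ bounded X :=
  lt_of_le_of_lt tsub_le_self (lt_top_of_mem_bounded hν _)

/-- The preimage of `{U | x ∈ U}` under `U ↦ U ⊓ T` is that set itself if `x ∈ T`, and is empty
otherwise. -/
lemma IsPointContinuous.restrict {ν : ContinuousValuation X} (hν : IsPointContinuous ν)
    (T : Opens X) : IsPointContinuous (ν.restrict T) := by
  let _ := pointwiseTopology X
  have h : Continuous fun U : Opens X => U ⊓ T := by
    refine continuous_generateFrom_iff.2 ?_
    rintro _ ⟨x, rfl⟩
    by_cases hx : x ∈ T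
    · have hopen : IsOpen {U : Opens X | x ∈ U} := isOpen_generateFrom_of_mem ⟨x, rfl⟩
      convert hopen using 1
      ext U
      exact and_iff_left hx
    · convert isOpen_empty using 1
      ext U
      exact iff_of_false (fun h => hx h.2) id
  exact Continuous.comp (g := fun U => WithScott.toScott (ν U)) hν h

lemma IsPointContinuous.restrictCompl {ν : ContinuousValuation X} (hν : IsPointContinuous ν)
    (hb : ν ∈ bounded X) (T : Opens X) : IsPointContinuous (ν.restrictCompl hb T) := by
  rw [isPointContinuous_iff] at hν ⊢
  let _ := pointwiseTopology X
  have h : Continuous fun U : Opens X => U ⊔ T := by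
    refine continuous_generateFrom_iff.2 ?_
    rintro _ ⟨x, rfl⟩
    by_cases hx : x ∈ T
    · convert isOpen_univ using 1
      ext U
      exact iff_of_true (Or.inr hx) trivial
    · have hopen : IsOpen {U : Opens X | x ∈ U} := isOpen_generateFrom_of_mem ⟨x, rfl⟩
      convert hopen using 1
      ext U
      exact or_iff_left hx
  exact (ENNReal.continuous_sub_right (ν T)).comp_lowerSemicontinuous (hν.comp h)
    fun _ _ h => tsub_le_tsub_right h _

/-- The value of a bounded valuation as a real number. -/
noncomputable def real (ν : ContinuousValuation X) (U : Opens X) : ℝ := (ν U).toReal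

section Real

variable {ν μ : ContinuousValuation X}

lemma real_add (hν : ν ∈ bounded X) (hμ : μ ∈ bounded X) (U : Opens X) :
    (ν + μ).real U = ν.real U + μ.real U :=
  ENNReal.toReal_add (lt_top_of_mem_bounded hν U).ne (lt_top_of_mem_bounded hμ U).ne

lemma real_smul (a : ℝ≥0) (U : Opens X) : (a • ν).real U = a * ν.real U := by
  rw [real, smul_apply, ENNReal.toReal_mul]
  rfl

lemma real_modular (hν : ν ∈ bounded X) (U V : Opens X) :
    ν.real U + ν.real V = ν.real (U ⊔ V) + ν.real (U ⊓ V) := by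
  have h := lt_top_of_mem_bounded hν
  rw [real, real, real, real, ← ENNReal.toReal_add (h _).ne (h _).ne, ν.modular,
    ENNReal.toReal_add (h _).ne (h _).ne]

lemma real_mono (hν : ν ∈ bounded X) {U V : Opens X} (h : U ≤ V) : ν.real U ≤ ν.real V :=
  ENNReal.toReal_mono (lt_top_of_mem_bounded hν V).ne (ν.mono h)

lemma real_restrictCompl (hν : ν ∈ bounded X) (T U : Opens X) :
    (ν.restrictCompl hν T).real U = ν.real U - ν.real (U ⊓ T) := by
  have h := real_add (restrict_mem_bounded hν T) (restrictCompl_mem_bounded hν T) U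
  rw [restrict_add_restrictCompl] at h
  rw [h]
  exact (add_sub_cancel_left ((ν.restrict T).real U) _).symm

end Real

/-- A cone of bounded continuous valuations stable under restriction to open sets and to their
complements. -/
structure IsRestrictionStable (S : Submodule ℝ≥0 (ContinuousValuation X)) : Prop where
  le_bounded : S ≤ bounded X
  restrict_mem : ∀ ν ∈ S, ∀ T, ν.restrict T ∈ S
  restrictCompl_mem : ∀ ν (hν : ν ∈ S) T, ν.restrictCompl (le_bounded hν) T ∈ S

lemma isRestrictionStable_bounded : IsRestrictionStable (bounded X) where
  le_bounded := le_rfl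
  restrict_mem _ hν T := restrict_mem_bounded hν T
  restrictCompl_mem _ hν T := restrictCompl_mem_bounded hν T

lemma isRestrictionStable_bounded_inf_pointContinuous :
    IsRestrictionStable (bounded X ⊓ pointContinuous X) where
  le_bounded := inf_le_left
  restrict_mem _ hν T := ⟨restrict_mem_bounded hν.1 T, IsPointContinuous.restrict hν.2 T⟩
  restrictCompl_mem _ hν T :=
    ⟨restrictCompl_mem_bounded hν.1 T, IsPointContinuous.restrictCompl hν.2 hν.1 T⟩

namespace IsRestrictionStable

variable {S : Submodule ℝ≥0 (ContinuousValuation X)} {L : Finset (Opens X)} {m : Opens X → ℝ}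

open Classical in
-- The induction is on the number of members of `L` not contained in the tight set `T`. Each round
-- shrinks the part `κ` of `ν` outside `T` as far as domination on `L` allows, which leaves the
-- value at `T` unchanged and enlarges the tight set.
lemma exists_summand_of_tight (hS : IsRestrictionStable S) (hL : IsSublattice (L : Set (Opens X)))
    (htop : ⊤ ∈ L) (hm : ∀ U V, m U + m V = m (U ⊔ V) + m (U ⊓ V)) (hmtop : ∀ U, m U ≤ m ⊤)
    (n : ℕ) : ∀ ν ∈ S, (∀ V ∈ L, m V ≤ ν.real V) → ∀ T ∈ L, ν.real T = m T →
      (L.filter fun V => ¬ V ≤ T).card ≤ n →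
      ∃ ν' ∈ S, ∃ ρ ∈ S, ν' + ρ = ν ∧ (∀ V ∈ L, m V ≤ ν'.real V) ∧ ν'.real ⊤ = m ⊤ := by
  induction n with
  | zero =>
    intro ν hν hle T hT htight hcard
    have hTtop : T = ⊤ := by
      by_contra h
      have : (⊤ : Opens X) ∈ L.filter fun V => ¬ V ≤ T :=
        Finset.mem_filter.2 ⟨htop, fun h' => h (top_le_iff.1 h')⟩
      rw [Finset.card_eq_zero.1 (Nat.le_zero.1 hcard)] at this
      exact Finset.notMem_empty _ this
    exact ⟨ν, hν, 0, S.zero_mem, add_zero ν, hle, hTtop ▸ htight⟩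
  | succ n ih =>
    intro ν hν hle T hT htight hcard
    have hb := hS.le_bounded hν
    set κ := ν.restrictCompl hb T with hκ
    have hκS : κ ∈ S := hS.restrictCompl_mem ν hν T
    have hrS : ν.restrict T ∈ S := hS.restrict_mem ν hν T
    have hsplit : ν.restrict T + κ = ν := restrict_add_restrictCompl ν hb T
    have hadd : ∀ V, ν.real V = (ν.restrict T).real V + κ.real V := fun V => by
      rw [← real_add (hS.le_bounded hrS) (hS.le_bounded hκS), hsplit]
    have hκ0 : ∀ V, 0 ≤ κ.real V := fun V => ENNReal.toReal_nonneg
    obtain ⟨V₀, hV₀, hmax⟩ := L.exists_max_image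
      (fun V => (m V - (ν.restrict T).real V) / κ.real V) ⟨⊤, htop⟩
    set c := (m V₀ - (ν.restrict T).real V₀) / κ.real V₀ with hc
    have hcV : ∀ d : ℝ, 0 ≤ d → c ≤ d → ∀ V ∈ L, m V ≤ (ν.restrict T).real V + d * κ.real V := by
      -- Where `κ` vanishes the quotient is `0` by convention and carries no information, but there
      -- `ν` agrees with its restriction to `T`, so the domination by `ν` is enough.
      intro d hd hcd V hV
      rcases (hκ0 V).eq_or_lt with h0 | hpos
      · have := hle V hV
        rw [hadd, ← h0] at this
        rw [← h0]
        linarith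
      · have := (hmax V hV).trans hcd
        rw [div_le_iff₀ hpos] at this
        linarith
    -- If `c ≤ 0`, the part inside `T` already dominates `m` on `L`; its mass `m T ≤ m ⊤` must then
    -- be `m ⊤`.
    rcases le_or_gt c 0 with hc0 | hc0
    · refine ⟨ν.restrict T, hrS, κ, hκS, hsplit, fun V hV => ?_, ?_⟩
      · simpa using hcV 0 le_rfl hc0 V hV
      · have h1 : (ν.restrict T).real ⊤ = m T := by
          rw [← htight, real, restrict_apply, top_inf_eq, real]
        refine le_antisymm (h1.trans_le (hmtop T)) ?_
        simpa using hcV 0 le_rfl hc0 ⊤ htop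
    · have hκV₀ : 0 < κ.real V₀ := by
        refine (hκ0 V₀).lt_of_ne' fun h => ?_
        rw [hc, h, div_zero] at hc0
        exact lt_irrefl _ hc0
      have hc1 : c ≤ 1 := by
        rw [hc, div_le_one hκV₀]
        have := hle V₀ hV₀
        rw [hadd] at this
        linarith
      set a : ℝ≥0 := ⟨c, hc0.le⟩ with ha
      have ha1 : a ≤ 1 := hc1
      set ν₁ := ν.restrict T + a • κ with hν₁
      have haκ : a • κ ∈ S := S.smul_mem a hκS
      have hν₁S : ν₁ ∈ S := S.add_mem hrS haκ
      have hval : ∀ V, ν₁.real V = (ν.restrict T).real V + c * κ.real V := fun V => by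
        rw [hν₁, real_add (hS.le_bounded hrS) (hS.le_bounded haκ), real_smul]
        rfl
      have hle₁ : ∀ V ∈ L, m V ≤ ν₁.real V := fun V hV => by
        rw [hval]
        exact hcV c hc0.le le_rfl V hV
      have hT₁ : ν₁.real T = m T := by
        rw [hval, hκ, real_restrictCompl, inf_idem, sub_self, mul_zero, add_zero, ← htight,
          real, restrict_apply, inf_idem, real]
      have hV₁ : ν₁.real V₀ = m V₀ := by
        rw [hval, hc, div_mul_cancel₀ _ hκV₀.ne']
        ring
      have hsup : T ⊔ V₀ ∈ L := hL.supClosed hT hV₀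
      have hinf : T ⊓ V₀ ∈ L := hL.infClosed hT hV₀
      -- By modularity the inequalities at the join and at the meet add up to an equality, so both
      -- are equalities.
      have htight₁ : ν₁.real (T ⊔ V₀) = m (T ⊔ V₀) := by
        have h1 := real_modular (hS.le_bounded hν₁S) T V₀
        have h2 := hm T V₀
        have h3 := hle₁ _ hinf
        have h4 := hle₁ _ hsup
        linarith
      -- `κ` vanishes on the open sets inside `T`, so the tight set really grows.
      have hnot : ¬ V₀ ≤ T := fun h => by
        rw [hκ, real_restrictCompl, inf_eq_left.2 h, sub_self] at hκV₀
        exact lt_irrefl _ hκV₀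
      have hcard₁ : (L.filter fun V => ¬ V ≤ T ⊔ V₀).card ≤ n := by
        refine Nat.le_of_lt_succ (lt_of_lt_of_le (Finset.card_lt_card ?_) hcard)
        refine Finset.ssubset_iff_of_subset ?_ |>.2 ⟨V₀, ?_, ?_⟩
        · exact Finset.monotone_filter_right _ fun V _ hV h => hV (h.trans le_sup_left)
        · exact Finset.mem_filter.2 ⟨hV₀, hnot⟩
        · exact fun h => (Finset.mem_filter.1 h).2 le_sup_right
      obtain ⟨ν', hν', ρ, hρ, hsum, hge, hmass⟩ := ih ν₁ hν₁S hle₁ _ hsup htight₁ hcard₁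
      -- The trimmed part `(1 - a) • κ` goes to the complementary summand.
      refine ⟨ν', hν', ρ + (1 - a) • κ, S.add_mem hρ (S.smul_mem _ hκS), ?_, hge, hmass⟩
      rw [← add_assoc, hsum, hν₁, add_assoc, ← add_smul, add_tsub_cancel_of_le ha1, one_smul,
        hsplit]

/-- If a bounded valuation dominates a modular function `m` on a finite lattice of open sets,
then it has a summand of mass `m ⊤` that still dominates `m` on that lattice. -/
lemma exists_summand (hS : IsRestrictionStable S) (hL : IsSublattice (L : Set (Opens X)))
    (htop : ⊤ ∈ L) (hbot : ⊥ ∈ L) (hm : ∀ U V, m U + m V = m (U ⊔ V) + m (U ⊓ V))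
    (hmtop : ∀ U, m U ≤ m ⊤) (hmbot : m ⊥ = 0) {ν : ContinuousValuation X} (hν : ν ∈ S)
    (hle : ∀ V ∈ L, m V ≤ ν.real V) :
    ∃ ν' ∈ S, ∃ ρ ∈ S, ν' + ρ = ν ∧ (∀ V ∈ L, m V ≤ ν'.real V) ∧ ν'.real ⊤ = m ⊤ :=
  hS.exists_summand_of_tight hL htop hm hmtop _ ν hν hle ⊥ hbot
    (by rw [hmbot, real, ν.strict, ENNReal.toReal_zero]) le_rfl

end IsRestrictionStable

end ContinuousValuation

/-! ### The weak topology, and the homeomorphism between `𝒞(P)` and `S` -/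

namespace ContinuousValuation

variable {X : Type u} [TopologicalSpace X]

lemma lowerSemicontinuous_eval (U : Opens X) :
    LowerSemicontinuous fun ν : ContinuousValuation X => ν U := by
  refine lowerSemicontinuous_iff_isOpen_preimage.2 fun y => isOpen_iff_forall_mem_open.2 ?_
  intro ν (hν : y < ν U)
  obtain ⟨r, hyr, hr⟩ := ENNReal.lt_iff_exists_nnreal_btwn.1 hν
  have hr0 : 0 < r := ENNReal.coe_pos.1 (bot_le.trans_lt hyr)
  exact ⟨{μ | (r : ℝ≥0∞) < μ U}, fun μ hμ => hyr.trans hμ,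
    isOpen_generateFrom_of_mem ⟨U, r, hr0, rfl⟩, hr⟩

lemma continuous_iff_lowerSemicontinuous {Z : Type*} [TopologicalSpace Z]
    {f : Z → ContinuousValuation X} :
    Continuous f ↔ ∀ U, LowerSemicontinuous fun z => f z U := by
  refine ⟨fun hf U => (lowerSemicontinuous_eval U).comp hf, fun h => ?_⟩
  refine continuous_generateFrom_iff.2 ?_
  rintro _ ⟨U, r, -, rfl⟩
  exact (h U).isOpen_preimage r

/-- Open neighborhoods in the weak topology are upwards-closed with respect to finitely many
open sets. -/
lemma exists_finset_of_isOpen {G : Set (ContinuousValuation X)} (hG : IsOpen G)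
    {ν : ContinuousValuation X} (hν : ν ∈ G) :
    ∃ F : Finset (Opens X), ∀ μ : ContinuousValuation X, (∀ V ∈ F, ν V ≤ μ V) → μ ∈ G := by
  classical
  induction hG with
  | basic s hs =>
    obtain ⟨U, r, -, rfl⟩ := hs
    exact ⟨{U}, fun μ hμ => lt_of_lt_of_le hν (hμ U (Finset.mem_singleton_self U))⟩
  | univ => exact ⟨∅, fun _ _ => trivial⟩
  | inter s t _ _ ihs iht =>
    obtain ⟨F, hF⟩ := ihs hν.1
    obtain ⟨F', hF'⟩ := iht hν.2
    exact ⟨F ∪ F', fun μ hμ => ⟨hF μ fun V hV => hμ V (Finset.mem_union_left _ hV),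
      hF' μ fun V hV => hμ V (Finset.mem_union_right _ hV)⟩⟩
  | sUnion K _ ih =>
    obtain ⟨s, hs, hνs⟩ := hν
    obtain ⟨F, hF⟩ := ih s hs hνs
    exact ⟨F, fun μ hμ => ⟨s, hs, hF μ hμ⟩⟩

lemma lowerSemicontinuous_coe_mul {t : ℝ≥0∞} (ht : t ≠ ∞) :
    LowerSemicontinuous fun a : WithScott ℝ≥0 => ((WithScott.ofScott a : ℝ≥0) : ℝ≥0∞) * t := by
  refine lowerSemicontinuous_iff_isOpen_preimage.2 fun y => isOpen_iff_forall_mem_open.2 ?_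
  intro a (ha : y < ((WithScott.ofScott a : ℝ≥0) : ℝ≥0∞) * t)
  have ha0 : 0 < WithScott.ofScott a := by
    refine pos_iff_ne_zero.2 fun h => ?_
    rw [h, ENNReal.coe_zero, zero_mul] at ha
    exact not_lt_zero ha
  have hc : Continuous fun b : ℝ≥0 => (b : ℝ≥0∞) * t :=
    (ENNReal.continuous_mul_const ht).comp ENNReal.continuous_coe
  have hev := hc.continuousAt.eventually_const_lt ha
  have : (𝓝[<] (WithScott.ofScott a)).NeBot := nhdsLT_neBot_of_exists_lt ⟨0, ha0⟩
  obtain ⟨s, hs, hsa⟩ := ((hev.filter_mono nhdsWithin_le_nhds).and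
    (self_mem_nhdsWithin (s := Set.Iio (WithScott.ofScott a)))).exists
  refine ⟨{b | s < WithScott.ofScott b}, fun b hb => ?_, isOpen_withScott_lt s, hsa⟩
  exact hs.trans_le (mul_le_mul_left (ENNReal.coe_le_coe.2 (le_of_lt hb)) t)

lemma IsRestrictionStable.semitopologicalCone {S : Submodule ℝ≥0 (ContinuousValuation X)}
    (hS : IsRestrictionStable S) : SemitopologicalCone S := by
  have hev (U : Opens X) : LowerSemicontinuous fun ν : S => ν.1 U :=
    (lowerSemicontinuous_eval U).comp continuous_subtype_val
  refine ⟨fun y => ?_, fun x => ?_, fun x => ?_, fun a => ?_⟩ <;>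
    refine continuous_induced_rng.2 (continuous_iff_lowerSemicontinuous.2 fun U => ?_)
  · exact (hev U).add (lowerSemicontinuous_const (z := y.1 U))
  · exact (lowerSemicontinuous_const (z := x.1 U)).add (hev U)
  · exact lowerSemicontinuous_coe_mul (lt_top_of_mem_bounded (hS.le_bounded x.2) U).ne
  · exact (ENNReal.continuous_const_mul ENNReal.coe_ne_top).comp_lowerSemicontinuous (hev U)
      fun _ _ h => mul_le_mul_right h _

/-- For `t < 1` and `ν` in `S` bounded, this is a neighborhood of `ν` on which `t • ν` is dominated
on `L`. The strict inequality makes it open; it would fail at `ν` itself where `ν V = 0`, but there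
nothing is required. -/
lemma isOpen_setOf_mul_lt (S : Submodule ℝ≥0 (ContinuousValuation X))
    (ν : ContinuousValuation X) (t : ℝ≥0)
    (L : Finset (Opens X)) :
    IsOpen {μ : S | ∀ V ∈ L, ν V = 0 ∨ (t : ℝ≥0∞) * ν V < μ.1 V} := by
  have : {μ : S | ∀ V ∈ L, ν V = 0 ∨ (t : ℝ≥0∞) * ν V < μ.1 V} =
      ⋂ V ∈ L, {μ : S | ν V = 0 ∨ (t : ℝ≥0∞) * ν V < μ.1 V} := by
    ext μ
    simp
  rw [this]
  refine isOpen_biInter_finset fun V _ => isOpen_const.union ?_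
  exact ((lowerSemicontinuous_eval V).comp continuous_subtype_val).isOpen_preimage _

/-- `P` is the barycentric algebra of valuations of total mass `1` in the cone `S`. -/
structure IsUnitSection (S : Submodule ℝ≥0 (ContinuousValuation X))
    (P : Set (ContinuousValuation X)) [BarycentricAlgebra P] : Prop where
  mem_iff : ∀ ν, ν ∈ P ↔ ν ∈ S ∧ ν ⊤ = 1
  coe_bary : ∀ (a : I) (x y : P), (bary a x y).1 =
    unitInterval.toNNReal a • x.1 + unitInterval.toNNReal (unitInterval.symm a) • y.1

namespace IsUnitSection

variable {S : Submodule ℝ≥0 (ContinuousValuation X)} {P : Set (ContinuousValuation X)}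
  [BarycentricAlgebra P]

/-- The inclusion of the valuations of mass `1`. -/
def incl (h : IsUnitSection S P) (ν : P) : S := ⟨ν.1, ((h.mem_iff _).1 ν.2).1⟩

lemma apply_top (h : IsUnitSection S P) (ν : P) : ν.1 ⊤ = 1 := ((h.mem_iff _).1 ν.2).2

lemma isAffineMap_incl (h : IsUnitSection S P) : IsAffineMap h.incl := fun a x y =>
  Subtype.ext (h.coe_bary a x y)

lemma continuous_incl (h : IsUnitSection S P) : Continuous h.incl :=
  continuous_induced_rng.2 continuous_subtype_val

lemma semitopologicalBarycentricAlgebra (h : IsUnitSection S P) :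
    SemitopologicalBarycentricAlgebra P := by
  have hev (U : Opens X) : LowerSemicontinuous fun ν : P => ν.1 U :=
    (lowerSemicontinuous_eval U).comp continuous_subtype_val
  have hsmul (a : ℝ≥0) (U : Opens X) :
      LowerSemicontinuous fun ν : P => (a : ℝ≥0∞) * ν.1 U :=
    (ENNReal.continuous_const_mul ENNReal.coe_ne_top).comp_lowerSemicontinuous (hev U)
      fun _ _ h => mul_le_mul_right h _
  have happ (a : I) (x y : P) (U : Opens X) : (bary a x y).1 U =
      (unitInterval.toNNReal a : ℝ≥0∞) * x.1 U +
        (unitInterval.toNNReal (unitInterval.symm a) : ℝ≥0∞) * y.1 U := by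
    rw [h.coe_bary]
    rfl
  have hfin (x : P) (U : Opens X) : x.1 U ≠ ∞ :=
    ((x.1.mono le_top).trans_lt ((h.apply_top x).trans_lt ENNReal.one_lt_top)).ne
  refine ⟨fun a y => ?_, fun x y => ?_, fun a x => ?_⟩ <;>
    refine continuous_induced_rng.2 (continuous_iff_lowerSemicontinuous.2 fun U => ?_) <;>
    simp only [Function.comp_apply, happ]
  · exact (hsmul _ U).add lowerSemicontinuous_const
  · have hc : Continuous fun a : I => (unitInterval.toNNReal a : ℝ≥0∞) :=
      ENNReal.continuous_coe.comp unitInterval.toNNReal_continuous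
    exact (((ENNReal.continuous_mul_const (hfin x U)).comp hc).add
      ((ENNReal.continuous_mul_const (hfin y U)).comp
        (hc.comp unitInterval.continuous_symm))).lowerSemicontinuous
  · exact lowerSemicontinuous_const.add (hsmul _ U)

/-- The canonical linear map from `𝒞(P)` to `S`. -/
noncomputable def toCone (h : IsUnitSection S P) : Conify P →ₗ[ℝ≥0] S :=
  Conify.lift h.incl h.isAffineMap_incl

lemma toCone_pair (h : IsUnitSection S P) (r : {r : ℝ≥0 // 0 < r}) (x : P) :
    (h.toCone (Conify.pair r x)).1 = r.1 • x.1 := rfl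

lemma toCone_pair_top (h : IsUnitSection S P) (r : {r : ℝ≥0 // 0 < r}) (x : P) :
    (h.toCone (Conify.pair r x)).1 ⊤ = r.1 := by
  rw [toCone_pair, smul_apply, h.apply_top, mul_one]

lemma toCone_pair_ne_zero (h : IsUnitSection S P) (r : {r : ℝ≥0 // 0 < r}) (x : P) :
    h.toCone (Conify.pair r x) ≠ 0 := fun h0 => by
  have := h.toCone_pair_top r x
  rw [h0] at this
  exact r.2.ne (ENNReal.coe_injective this)

lemma toCone_bijective (h : IsUnitSection S P) (hS : IsRestrictionStable S) :
    Function.Bijective h.toCone := by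
  constructor
  · intro u v huv
    cases u with
    | zero =>
      cases v with
      | zero => rfl
      | pair s y => exact absurd (huv.symm.trans h.toCone.map_zero) (h.toCone_pair_ne_zero s y)
    | pair r x =>
      cases v with
      | zero => exact absurd (huv.trans h.toCone.map_zero) (h.toCone_pair_ne_zero r x)
      | pair s y =>
        have hrs : r = s := by
          have := h.toCone_pair_top r x
          rw [huv, h.toCone_pair_top] at this
          exact Subtype.ext (ENNReal.coe_injective this).symm
        subst hrs
        have hxy : r.1 • x.1 = r.1 • y.1 := congrArg Subtype.val huv
        have := congrArg (r.1⁻¹ • ·) hxy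
        simp only [smul_smul, inv_mul_cancel₀ r.2.ne', one_smul] at this
        rw [Subtype.ext this]
  · intro ν
    have hfin : ν.1 ⊤ ≠ ∞ := ne_of_lt (hS.le_bounded ν.2)
    obtain ⟨r, hr⟩ : ∃ r : ℝ≥0, (r : ℝ≥0∞) = ν.1 ⊤ := ⟨_, ENNReal.coe_toNNReal hfin⟩
    rcases eq_or_lt_of_le (zero_le (a := r)) with rfl | hr0
    · refine ⟨0, h.toCone.map_zero.trans (Subtype.ext (ContinuousValuation.ext ?_))⟩
      funext U
      exact (le_antisymm ((ν.1.mono le_top).trans hr.symm.le) bot_le).symm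
    · refine ⟨Conify.pair ⟨r, hr0⟩ ⟨r⁻¹ • ν.1, (h.mem_iff _).2 ⟨S.smul_mem _ ν.2, ?_⟩⟩, ?_⟩
      · rw [smul_apply, ← hr, ← ENNReal.coe_mul, inv_mul_cancel₀ hr0.ne', ENNReal.coe_one]
      · apply Subtype.ext
        rw [toCone_pair, smul_smul, mul_inv_cancel₀ hr0.ne', one_smul]

/-- The canonical linear isomorphism between `𝒞(P)` and `S`. -/
noncomputable def linearEquiv (h : IsUnitSection S P) (hS : IsRestrictionStable S) :
    Conify P ≃ₗ[ℝ≥0] S :=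
  LinearEquiv.ofBijective h.toCone (h.toCone_bijective hS)

lemma linearEquiv_pair (h : IsUnitSection S P) (hS : IsRestrictionStable S)
    (r : {r : ℝ≥0 // 0 < r}) (x : P) :
    (h.linearEquiv hS (Conify.pair r x)).1 = r.1 • x.1 := rfl

lemma continuous_linearEquiv_symm (h : IsUnitSection S P) (hS : IsRestrictionStable S) :
    Continuous (h.linearEquiv hS).symm := by
  classical
  set e := h.linearEquiv hS with he
  have : DenselyOrdered {r : ℝ≥0 // 0 < r} :=
    inferInstanceAs (DenselyOrdered (Set.Ioi (0 : ℝ≥0)))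
  refine continuous_generateFrom_iff.2 ?_
  rintro W ⟨hW0, hWo, hWup⟩
  refine isOpen_iff_forall_mem_open.2 fun ν₀ (hν₀ : e.symm ν₀ ∈ W) => ?_
  obtain ⟨u₀, rfl⟩ := e.surjective ν₀
  rw [e.symm_apply_apply] at hν₀
  cases u₀ with
  | zero => exact absurd hν₀ hW0
  | pair r₀ x₀ =>
  obtain ⟨O, U', hO, hU', hrO, hxU', hOU'⟩ := isOpen_prod_iff.1 hWo (WithScott.toScott r₀) x₀ hν₀
  -- The order is that of the positive scalars, so `r₀ / 2`, not `0`, witnesses an element below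
  -- `r₀`.
  obtain ⟨s, hsr, hsO⟩ := exists_lt_mem_of_isOpen_withScott hO hrO
    ⟨⟨r₀.1 / 2, half_pos r₀.2⟩, NNReal.half_lt_self r₀.2.ne'⟩
  obtain ⟨G, hG, rfl⟩ := isOpen_induced_iff.1 hU'
  obtain ⟨F, hF⟩ := exists_finset_of_isOpen hG hxU'
  -- Finitely many elements of a distributive lattice generate a finite sublattice. The trimming
  -- starts from the tight set `⊥` and ends at `⊤`, so both are put in.
  have hLfin : (latticeClosure (insert ⊤ (insert ⊥ (F : Set (Opens X))))).Finite :=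
    ((F.finite_toSet.insert _).insert _).latticeClosure
  set L := hLfin.toFinset with hLdef
  have hL : IsSublattice (L : Set (Opens X)) := by
    rw [hLdef, Set.Finite.coe_toFinset]
    exact isSublattice_latticeClosure
  have hmemL {V : Opens X} (hV : V ∈ insert ⊤ (insert ⊥ (F : Set (Opens X)))) : V ∈ L :=
    hLfin.mem_toFinset.2 (subset_latticeClosure hV)
  set t : ℝ≥0 := s.1 / r₀.1 with ht
  have ht1 : t < 1 := (div_lt_one r₀.2).2 hsr
  have htr : t * r₀.1 = s.1 := div_mul_cancel₀ _ r₀.2.ne'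
  set ν₀ := e (Conify.pair r₀ x₀) with hν₀def
  have hν₀eq : t • ν₀.1 = s.1 • x₀.1 := by
    rw [hν₀def, he, linearEquiv_pair, smul_smul, htr]
  have hx₀S := ((h.mem_iff _).1 x₀.2).1
  have hsxb : s.1 • x₀.1 ∈ bounded X := hS.le_bounded (S.smul_mem _ hx₀S)
  refine ⟨_, ?_, isOpen_setOf_mul_lt S ν₀.1 t L, ?_⟩
  · intro ν hν
    have hle : ∀ V ∈ L, (s.1 • x₀.1).real V ≤ ν.1.real V := by
      intro V hV
      refine ENNReal.toReal_mono (lt_top_of_mem_bounded (hS.le_bounded ν.2) V).ne ?_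
      rw [← hν₀eq, smul_apply]
      rcases hν V hV with h0 | hlt
      · rw [h0, mul_zero]
        exact bot_le
      · exact hlt.le
    obtain ⟨ν', hν', ρ, hρ, hsum, hge, hmass⟩ := hS.exists_summand hL (hmemL (by simp))
      (hmemL (by simp)) (real_modular hsxb) (fun U => real_mono hsxb le_top)
      (by rw [real, ContinuousValuation.strict, ENNReal.toReal_zero]) ν.2 hle
    obtain ⟨u', hu'⟩ := e.surjective ⟨ν', hν'⟩
    have hx₀top : x₀.1.real ⊤ = 1 := by rw [real, h.apply_top, ENNReal.toReal_one]
    rw [real_smul, hx₀top, mul_one] at hmass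
    cases u' with
    | zero =>
      have h0 : ν' = 0 := congrArg Subtype.val (hu'.symm.trans e.map_zero)
      rw [h0] at hmass
      exact absurd hmass.symm (NNReal.coe_ne_zero.2 s.2.ne')
    | pair s' y =>
    have hν'eq : s'.1 • y.1 = ν' := congrArg Subtype.val hu'
    have hytop : y.1.real ⊤ = 1 := by rw [real, h.apply_top, ENNReal.toReal_one]
    rw [← hν'eq, real_smul, hytop, mul_one] at hmass
    obtain rfl : s' = s := Subtype.ext (NNReal.coe_injective hmass)
    have hyW : Conify.pair s' y ∈ W := by
      refine hOU' (Set.mk_mem_prod hsO (hF y.1 fun V hV => ?_))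
      have h1 := hge V (hmemL (by simp [hV]))
      rw [← hν'eq, real_smul, real_smul] at h1
      have h2 : x₀.1.real V ≤ y.1.real V := le_of_mul_le_mul_left h1 s'.2
      exact (ENNReal.toReal_le_toReal (lt_top_of_mem_bounded (hS.le_bounded hx₀S) V).ne
        (lt_top_of_mem_bounded (hS.le_bounded ((h.mem_iff _).1 y.2).1) V).ne).1 h2
    have hdecomp : Conify.pair s' y + e.symm ⟨ρ, hρ⟩ = e.symm ν := by
      rw [← e.symm_apply_apply (Conify.pair s' y), hu', ← map_add]
      exact congrArg e.symm (Subtype.ext hsum)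
    -- `(s', y)` is a summand of the preimage of `ν`, hence below it. The case split only displays
    -- that preimage as a pair.
    refine hWup _ _ (Or.inr ?_) hyW
    rw [← hdecomp]
    cases e.symm ⟨ρ, hρ⟩ with
    | zero => exact ⟨_, _, rfl, 0, _, rfl, fun _ _ => id⟩
    | pair r z => exact ⟨_, _, rfl, Conify.pair r z, _, rfl, fun _ _ => id⟩
  · intro V _
    refine or_iff_not_imp_left.2 fun h0 => ?_
    obtain ⟨a, ha⟩ : ∃ a : ℝ≥0, (a : ℝ≥0∞) = ν₀.1 V :=
      ⟨_, ENNReal.coe_toNNReal (lt_top_of_mem_bounded (hS.le_bounded ν₀.2) V).ne⟩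
    rw [← ha] at h0 ⊢
    rw [← ENNReal.coe_mul, ENNReal.coe_lt_coe]
    exact mul_lt_of_lt_one_left (pos_iff_ne_zero.2 fun h => h0 (by rw [h]; rfl)) ht1

/-- The canonical linear homeomorphism between `𝒞(P)` and `S`. -/
noncomputable def continuousLinearEquiv (h : IsUnitSection S P) (hS : IsRestrictionStable S) :
    Conify P ≃L[ℝ≥0] S where
  toLinearEquiv := h.linearEquiv hS
  continuous_toFun :=
    have := hS.semitopologicalCone
    Conify.continuous_lift (hf := h.isAffineMap_incl) h.continuous_incl
  continuous_invFun := h.continuous_linearEquiv_symm hS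

lemma continuousLinearEquiv_eta (h : IsUnitSection S P) (hS : IsRestrictionStable S) (x : P) :
    h.continuousLinearEquiv hS (Conify.eta x) = h.incl x :=
  Conify.lift_eta (hf := h.isAffineMap_incl) x

/-- The structure is pulled back from `S`, where it follows from lower semicontinuity of
evaluations, rather than checked on the cone topology. -/
lemma semitopologicalCone_conify (h : IsUnitSection S P) (hS : IsRestrictionStable S) :
    SemitopologicalCone (Conify P) :=
  have := hS.semitopologicalCone
  SemitopologicalCone.of_continuousLinearEquiv (h.continuousLinearEquiv hS)

lemma isFreeCone_incl (h : IsUnitSection S P) (hS : IsRestrictionStable S) :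
    IsFreeCone.{u, u, w} h.incl :=
  Conify.isFreeCone_of_linearEquiv h.isAffineMap_incl (h.linearEquiv hS)
    (h.continuousLinearEquiv_eta hS)

lemma isFreeSemitopologicalCone_incl (h : IsUnitSection S P) (hS : IsRestrictionStable S) :
    IsFreeSemitopologicalCone.{u, u, w} h.incl :=
  have := hS.semitopologicalCone
  have := h.semitopologicalBarycentricAlgebra
  Conify.isFreeSemitopologicalCone_of_continuousLinearEquiv h.isAffineMap_incl
    h.continuous_incl (h.continuousLinearEquiv hS) (h.continuousLinearEquiv_eta hS)

end IsUnitSection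

variable (X)

lemma isUnitSection_probability : IsUnitSection (bounded X) (probability X) where
  mem_iff _ := ⟨fun h => ⟨probability_subset_bounded h, h⟩, fun h => h.2⟩
  coe_bary _ _ _ := rfl

lemma isUnitSection_probability_inter_pointContinuous :
    IsUnitSection (bounded X ⊓ pointContinuous X) (probability X ∩ pointContinuous X) where
  mem_iff _ := ⟨fun h => ⟨⟨probability_subset_bounded h.1, h.2⟩, h.1⟩, fun h => ⟨h.2, h.1.2⟩⟩
  coe_bary _ _ _ := rfl

end ContinuousValuation

theorem mainTheorem4 :
    -- for every `X`, `V_b X` is the free cone and the free semitopological cone over `V_1 X`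
    (∀ (X : Type u) [TopologicalSpace X],
      IsFreeCone.{u, u, w} (V1.incl : V1 X → Vb X) ∧
      IsFreeSemitopologicalCone.{u, u, w} (V1.incl : V1 X → Vb X)) ∧
    -- `V_b X` and `𝒞(V_1 X)` are naturally isomorphic semitopological cones
    (∀ (X : Type u) [TopologicalSpace X], SemitopologicalCone (Conify (V1 X))) ∧
    (∃ Φ : ∀ (X : Type u) [TopologicalSpace X], Conify (V1 X) ≃L[ℝ≥0] Vb X,
      (∀ (X : Type u) [TopologicalSpace X] (ν : V1 X), Φ X (Conify.eta ν) = V1.incl ν) ∧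
      (∀ (X Y : Type u) [TopologicalSpace X] [TopologicalSpace Y] (g : C(X, Y))
        (z : Conify (V1 X)), Φ Y (Conify.map (V1.map g) z) = Vb.map g (Φ X z))) ∧
    -- the same for point-continuous valuations
    (∀ (X : Type u) [TopologicalSpace X],
      IsFreeCone.{u, u, w} (V1p.incl : V1p X → Vbp X) ∧
      IsFreeSemitopologicalCone.{u, u, w} (V1p.incl : V1p X → Vbp X)) ∧
    (∀ (X : Type u) [TopologicalSpace X], SemitopologicalCone (Conify (V1p X))) ∧
    (∃ Φ : ∀ (X : Type u) [TopologicalSpace X], Conify (V1p X) ≃L[ℝ≥0] Vbp X,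
      (∀ (X : Type u) [TopologicalSpace X] (ν : V1p X), Φ X (Conify.eta ν) = V1p.incl ν) ∧
      (∀ (X Y : Type u) [TopologicalSpace X] [TopologicalSpace Y] (g : C(X, Y))
        (z : Conify (V1p X)), Φ Y (Conify.map (V1p.map g) z) = Vbp.map g (Φ X z))) := by
  refine ⟨fun X _ => ⟨(isUnitSection_probability X).isFreeCone_incl isRestrictionStable_bounded,
      (isUnitSection_probability X).isFreeSemitopologicalCone_incl isRestrictionStable_bounded⟩,
    fun X _ => (isUnitSection_probability X).semitopologicalCone_conify
      isRestrictionStable_bounded,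
    ⟨fun X _ => (isUnitSection_probability X).continuousLinearEquiv isRestrictionStable_bounded,
      fun X _ ν => (isUnitSection_probability X).continuousLinearEquiv_eta _ ν,
      fun X Y _ _ g z => ?_⟩,
    fun X _ => ⟨(isUnitSection_probability_inter_pointContinuous X).isFreeCone_incl
        isRestrictionStable_bounded_inf_pointContinuous,
      (isUnitSection_probability_inter_pointContinuous X).isFreeSemitopologicalCone_incl
        isRestrictionStable_bounded_inf_pointContinuous⟩,
    fun X _ => (isUnitSection_probability_inter_pointContinuous X).semitopologicalCone_conify
      isRestrictionStable_bounded_inf_pointContinuous,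
    ⟨fun X _ => (isUnitSection_probability_inter_pointContinuous X).continuousLinearEquiv
        isRestrictionStable_bounded_inf_pointContinuous,
      fun X _ ν => (isUnitSection_probability_inter_pointContinuous X).continuousLinearEquiv_eta
        _ ν,
      fun X Y _ _ g z => ?_⟩⟩
  -- Image valuations commute with scalar multiples by definition.
  · cases z <;> rfl
  · cases z <;> rfl
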